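/- Let $n$ be a positive integer and equip $\mathbb{R}^n$ with the normalized Euclidean norm $\|x\|=\bigl(\frac1n\sum_{i=1}^n x_i^2\bigr)^{1/2}$. For $x\in\mathbb{R}^n\setminus\{0\}$ and $J\subset\{1,\dots,n\}$ put $\mu_x(J)=\|P_Jx\|^2/\|x\|^2$, where $P_J$ is the coordinate projection onto $J$; that is, $\mu_x(J)=\sum_{i\in J}x_i^2/\sum_{i=1}^n x_i^2$. For $\gamma\in(0,1]$ let \[\Delta_\gamma=\bigl\{x\in\mathbb{R}^n\setminus\{0\}:\ \mu_x\{i:\ |x_i|=4^m\text{ for some }m\in\mathbb{Z}\}\ge\gamma\bigr\},\] and for $\eta>0$ let $(\Delta_\gamma)_\eta$ be its $\eta$-expansion, the set of all points of $\mathbb{R}^n$ at $\|\cdot\|$-distance at most $\eta$ from $\Delta_\gamma$. Let $\mathbb{P}$ refer to a uniformly distributed random vector $x$ of the unit sphere $\{x\in\mathbb{R}^n:\|x\|=1\}$. (i) For every $\beta\in(0,1]$ there are $\eta_0\in(0,\frac12)$ and $\sigma\in(0,1)$ such that for every $\eta\in(0,\eta_0]$ and all sufficiently large $n$, \[\mathbb{P}\bigl[x\in(\Delta_{\beta(1-2\eta)})_\eta\bigr]\le\sigma^n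 .\] (ii) If $\eta=10^{-12}$ and $\beta=\frac1{257}$, then for all sufficiently large $n$, \[\mathbb{P}\bigl[x\in(\Delta_{\beta(1-2\eta)})_\eta\bigr]\le 4e\,n^2\log n\,(0.9982)^n .\] -/

import Mathlib

open MeasureTheory Filter

noncomputable section

namespace TennisBall

/-- The normalized norm of `L₂ⁿ`: `‖x‖² = n⁻¹ ∑ᵢ xᵢ²`. -/
def avgNorm {n : ℕ} (x : EuclideanSpace ℝ (Fin n)) : ℝ :=
  Real.sqrt ((n : ℝ)⁻¹ * ∑ i, (x i) ^ 2)

/-- The coordinate projection `P_J`. -/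
def coordProj {n : ℕ} (J : Set (Fin n)) (x : EuclideanSpace ℝ (Fin n)) :
    EuclideanSpace ℝ (Fin n) :=
  WithLp.toLp 2 (J.indicator (fun i => x i))

/-- The weight `μ_x(J) = ‖P_J x‖² / ‖x‖²` (meaningful for `x ≠ 0`). -/
def coordWeight {n : ℕ} (x : EuclideanSpace ℝ (Fin n)) (J : Set (Fin n)) : ℝ :=
  avgNorm (coordProj J x) ^ 2 / avgNorm x ^ 2

/-- `t` is a `ξ`-approximate power of `lam`. For `ξ = 0` this says `t = lam ^ m` for some
integer `m`. -/
def IsApproxPower (lam ξ t : ℝ) : Prop :=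
  ∃ m : ℤ, (1 + ξ)⁻¹ * lam ^ m ≤ t ∧ t ≤ (1 + ξ) * lam ^ m

/-- The set `Δ_γ^ξ ⊆ ℝⁿ` for the base `lam`. -/
def DeltaApprox (n : ℕ) (lam γ ξ : ℝ) : Set (EuclideanSpace ℝ (Fin n)) :=
  {x | x ≠ 0 ∧ γ ≤ coordWeight x {i | IsApproxPower lam ξ |x i|}}

/-- The set `Δ_γ = Δ_γ^0`. -/
def Delta (n : ℕ) (lam γ : ℝ) : Set (EuclideanSpace ℝ (Fin n)) :=
  DeltaApprox n lam γ 0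

/-- The `ε`-expansion of a set, with respect to the normalized norm of `L₂ⁿ`. -/
def expansion {n : ℕ} (ε : ℝ) (A : Set (EuclideanSpace ℝ (Fin n))) :
    Set (EuclideanSpace ℝ (Fin n)) :=
  {x | ∃ a ∈ A, avgNorm (x - a) ≤ ε}

/-- The law of a uniformly random unit vector of `L₂ⁿ`: normalized surface measure on the Euclidean
unit sphere, pushed forward under `u ↦ √n u`, whose image is `{x | avgNorm x = 1}`. -/
def unitVectorLaw (n : ℕ) : Measure (EuclideanSpace ℝ (Fin n)) :=
  Measure.map
    (fun u : Metric.sphere (0 : EuclideanSpace ℝ (Fin n)) 1 =>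
      Real.sqrt n • (u : EuclideanSpace ℝ (Fin n)))
    (((volume : Measure (EuclideanSpace ℝ (Fin n))).toSphere Set.univ)⁻¹ •
      (volume : Measure (EuclideanSpace ℝ (Fin n))).toSphere)

end TennisBall

end

namespace TennisBall

open Real Pointwise

/-! A point close to `Delta` carries almost a fraction γ of its squared norm on coordinates within
relative error ξ of powers of 4, provided η is small against ξ (`mem_heavySet_of_near`). For a
Gaussian coordinate this event has probability O(ξ), since the scales contribute a geometric series.
A Chernoff bound with tilt s < 1/2 therefore gives such points in the ball of radius √n a volume
share of at most 3n · exp(27ξ/(1/2 - s) - sb)^n, where b is close to γ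
(`volume_heavySet_le_volume_ball`). Comparing the sphere with a thin shell costs a factor 2. The
exponent is negative once ξ is small against γ. -/

/-! ### Gaussian mass near the powers of 4 -/

/-- The reals whose absolute value is within relative distance `ξ` of an integer power of `4`. -/
def nearPowers (ξ : ℝ) : Set ℝ := {t | ∃ m : ℤ, |(|t| - (4 : ℝ) ^ m)| ≤ ξ * (4 : ℝ) ^ m}

theorem nearPowers_eq_iUnion (ξ : ℝ) :
    nearPowers ξ = ⋃ m : ℤ, {t : ℝ | |(|t| - (4 : ℝ) ^ m)| ≤ ξ * (4 : ℝ) ^ m} := by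
  ext t; simp [nearPowers]

theorem measurableSet_nearPowers (ξ : ℝ) : MeasurableSet (nearPowers ξ) := by
  rw [nearPowers_eq_iUnion]
  refine MeasurableSet.iUnion fun m => IsClosed.measurableSet ?_
  exact isClosed_le (by fun_prop) continuous_const

theorem hasSum_quarter_pow_natAbs :
    HasSum (fun m : ℤ => (1 / 4 : ℝ) ^ m.natAbs) (5 / 3) := by
  have h := hasSum_geometric_of_lt_one (r := (1 / 4 : ℝ)) (by norm_num) (by norm_num)
  rw [show (1 - 1 / 4 : ℝ)⁻¹ = 4 / 3 by norm_num] at h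
  have h2 : HasSum (fun k : ℕ => (1 / 4 : ℝ) ^ (-((k : ℤ) + 1)).natAbs) (1 / 3) := by
    have h3 : (fun k : ℕ => (1 / 4 : ℝ) ^ (-((k : ℤ) + 1)).natAbs)
        = fun k : ℕ => 1 / 4 * (1 / 4 : ℝ) ^ k := by
      ext k
      rw [show (-((k : ℤ) + 1)).natAbs = k + 1 by omega, pow_succ']
    rw [h3, show (1 / 3 : ℝ) = 1 / 4 * (4 / 3) by norm_num]
    exact h.mul_left _
  rw [show (5 / 3 : ℝ) = 4 / 3 + 1 / 3 by norm_num]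
  exact HasSum.of_nat_of_neg_add_one (f := fun m : ℤ => (1 / 4 : ℝ) ^ m.natAbs)
    (by simpa only [Int.natAbs_natCast] using h) h2

/-- Multiplied by the length, of order ξ · 4^m, of the set around ±4^m, this bound is summable over
all m. Large scales use u·exp(-u) ≤ 1 with u = c·t²; for small scales the length alone decays. -/
theorem zpow_four_mul_exp_le {c ξ t : ℝ} (hc : 0 < c) (hc4 : c ≤ 1) (hξ4 : ξ ≤ 1 / 4) {m : ℤ}
    (ht : |(|t| - (4 : ℝ) ^ m)| ≤ ξ * (4 : ℝ) ^ m) :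
    exp (-c * t ^ 2) ≤ 4 / c * (1 / 4 : ℝ) ^ m.natAbs / (4 : ℝ) ^ m := by
  have hp : (0 : ℝ) < 4 ^ m := by positivity
  rw [le_div_iff₀ hp]
  rcases le_or_gt 0 m with hm | hm
  · lift m to ℕ using hm
    simp only [zpow_natCast, Int.natAbs_natCast] at *
    have h1 : 3 / 4 * (4 : ℝ) ^ m ≤ |t| := by
      have := (abs_le.1 ht).1
      nlinarith
    have h2 : (3 / 4 * (4 : ℝ) ^ m) ^ 2 ≤ t ^ 2 := by
      rw [← sq_abs t]; gcongr
    have h3 : exp (-c * t ^ 2) * (c * t ^ 2) ≤ 1 := by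
      have := add_one_le_exp (c * t ^ 2)
      rw [neg_mul, exp_neg, inv_mul_le_iff₀ (exp_pos _)]
      linarith
    have h4 : exp (-c * t ^ 2) * (c * (3 / 4 * (4 : ℝ) ^ m) ^ 2) ≤ 1 := by
      refine le_trans ?_ h3
      gcongr
    rw [one_div, inv_pow, ← div_eq_mul_inv, div_div, le_div_iff₀ (by positivity)]
    nlinarith
  · have h1 : exp (-c * t ^ 2) ≤ 1 := by
      rw [exp_le_one_iff]; nlinarith [sq_nonneg t]
    have h2 : (1 / 4 : ℝ) ^ m.natAbs = 4 ^ m := by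
      obtain ⟨k, rfl⟩ : ∃ k : ℕ, m = -(k : ℤ) := ⟨m.natAbs, by omega⟩
      simp
    rw [h2]
    have : 1 ≤ 4 / c := by rw [le_div_iff₀ hc]; linarith
    nlinarith

theorem lintegral_nearPowers_le {c ξ : ℝ} (hc : 0 < c) (hc4 : c ≤ 1) (hξ : 0 < ξ)
    (hξ4 : ξ ≤ 1 / 4) :
    ∫⁻ t in nearPowers ξ, ENNReal.ofReal (exp (-c * t ^ 2)) ≤ ENNReal.ofReal (27 * ξ / c) := by
  rw [nearPowers_eq_iUnion]
  have hs := hasSum_quarter_pow_natAbs.mul_left (16 * ξ / c)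
  calc _ ≤ ∑' m : ℤ, ∫⁻ t in {t : ℝ | |(|t| - (4 : ℝ) ^ m)| ≤ ξ * (4 : ℝ) ^ m},
        ENNReal.ofReal (exp (-c * t ^ 2)) := lintegral_iUnion_le _ _
    _ ≤ ∑' m : ℤ, ENNReal.ofReal (16 * ξ / c * (1 / 4 : ℝ) ^ m.natAbs) := by
        refine ENNReal.tsum_le_tsum fun m => ?_
        have hp : (0 : ℝ) < 4 ^ m := by positivity
        have hmeas : MeasurableSet {t : ℝ | |(|t| - (4 : ℝ) ^ m)| ≤ ξ * (4 : ℝ) ^ m} :=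
          (isClosed_le (by fun_prop) continuous_const).measurableSet
        have hvol : volume {t : ℝ | |(|t| - (4 : ℝ) ^ m)| ≤ ξ * (4 : ℝ) ^ m}
            ≤ ENNReal.ofReal (4 * ξ * 4 ^ m) := by
          calc _ ≤ volume (Set.Icc ((1 - ξ) * (4 : ℝ) ^ m) ((1 + ξ) * 4 ^ m) ∪
                Set.Icc (-((1 + ξ) * (4 : ℝ) ^ m)) (-((1 - ξ) * 4 ^ m))) := by
                refine measure_mono fun t ht => ?_
                have ht := abs_le.1 (Set.mem_ofPred_eq ▸ ht)
                simp only [Set.mem_union, Set.mem_Icc]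
                rcases abs_cases t with h | h
                · left; constructor <;> nlinarith
                · right; constructor <;> nlinarith
            _ ≤ _ := measure_union_le _ _
            _ = _ := by
                rw [volume_Icc, volume_Icc, ← ENNReal.ofReal_add (by nlinarith) (by nlinarith)]
                congr 1; ring
        calc _ ≤ ∫⁻ t in {t : ℝ | |(|t| - (4 : ℝ) ^ m)| ≤ ξ * (4 : ℝ) ^ m},
              ENNReal.ofReal (4 / c * (1 / 4 : ℝ) ^ m.natAbs / (4 : ℝ) ^ m) := by
              refine setLIntegral_mono' hmeas fun t ht => ?_
              exact ENNReal.ofReal_le_ofReal (zpow_four_mul_exp_le hc hc4 hξ4 ht)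
          _ = ENNReal.ofReal (4 / c * (1 / 4 : ℝ) ^ m.natAbs / (4 : ℝ) ^ m) *
              volume {t : ℝ | |(|t| - (4 : ℝ) ^ m)| ≤ ξ * (4 : ℝ) ^ m} := by
              rw [setLIntegral_const]
          _ ≤ ENNReal.ofReal (4 / c * (1 / 4 : ℝ) ^ m.natAbs / (4 : ℝ) ^ m) *
              ENNReal.ofReal (4 * ξ * 4 ^ m) := by gcongr
          _ = _ := by
              rw [← ENNReal.ofReal_mul (by positivity)]
              congr 1; field_simp; ring
    _ = ENNReal.ofReal (16 * ξ / c * (5 / 3)) := by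
        rw [← hs.tsum_eq, ENNReal.ofReal_tsum_of_nonneg (fun m => by positivity) hs.summable]
    _ ≤ _ := by
        apply ENNReal.ofReal_le_ofReal
        rw [div_mul_eq_mul_div]
        exact div_le_div_of_nonneg_right (by linarith) hc.le

/-! ### A Stirling-type bound for the volume of the ball -/

theorem Gamma_half_add_one_le (n : ℕ) (hn : 0 < n) :
    Gamma (n / 2 + 1) * √(2 * exp 1) ^ n ≤ 3 * n * √n ^ n := by
  have he := exp_one_lt_d9
  induction n using Nat.twoStepInduction with
  | zero => omega
  | one =>
    have h1 : Gamma ((1 : ℕ) / 2 + 1) = √π / 2 := by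
      rw [Nat.cast_one, Gamma_add_one (by norm_num), Gamma_one_half_eq]; ring
    rw [h1]
    have h2 : √π ≤ 2 := by rw [sqrt_le_left (by norm_num)]; linarith [pi_lt_d2]
    have h3 : √(2 * exp 1) ≤ 3 := by rw [sqrt_le_left (by norm_num)]; linarith
    have := sqrt_nonneg (2 * exp 1)
    have := sqrt_nonneg π
    simp only [pow_one, Nat.cast_one, sqrt_one]
    nlinarith
  | more n ih _ =>
    -- The inequality fails at 0, so dimension 2 is a second base case.
    rcases Nat.eq_zero_or_pos n with rfl | hn0
    · rw [zero_add, sq_sqrt (by positivity), sq_sqrt (by positivity)]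
      norm_num [Gamma_two]
      linarith
    · have ih := ih hn0
      have hnr : (0 : ℝ) < n := by exact_mod_cast hn0
      have hG : Gamma (((n + 2 : ℕ) : ℝ) / 2 + 1) = (n / 2 + 1) * Gamma (n / 2 + 1) := by
        rw [← Gamma_add_one (by positivity)]; congr 1; push_cast; ring
      rw [hG, pow_add, sq_sqrt (by positivity)]
      have hkey : exp 1 * n * √n ^ n ≤ √((n + 2 : ℕ) : ℝ) ^ n * (n + 2) := by
        have h1 : exp 1 ≤ ((n + 2) / n : ℝ) ^ ((n : ℝ) / 2 + 1) := by
          have hl : 1 - ((n + 2) / n : ℝ)⁻¹ ≤ log ((n + 2) / n : ℝ) :=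
            one_sub_inv_le_log_of_pos (by positivity)
          rw [← exp_log (show (0 : ℝ) < ((n + 2) / n : ℝ) by positivity), ← exp_mul, exp_le_exp]
          have : (1 - ((n + 2) / n : ℝ)⁻¹) * (n / 2 + 1) = 1 := by field_simp; ring
          calc (1 : ℝ) = _ := this.symm
            _ ≤ _ := mul_le_mul_of_nonneg_right hl (by positivity)
        have h2 : ((n + 2) / n : ℝ) ^ ((n : ℝ) / 2 + 1)
            = √((n + 2 : ℕ) : ℝ) ^ n * (n + 2) / (√n ^ n * n) := by
          rw [rpow_add (by positivity), rpow_one, rpow_div_two_eq_sqrt _ (by positivity),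
            rpow_natCast, sqrt_div (by positivity), div_pow]
          push_cast
          field_simp
        rw [h2, le_div_iff₀ (by positivity)] at h1
        linarith
      calc _ = (Gamma (n / 2 + 1) * √(2 * exp 1) ^ n) * ((n + 2) * exp 1) := by ring
        _ ≤ (3 * n * √n ^ n) * ((n + 2) * exp 1) := by gcongr
        _ = 3 * (n + 2) * (exp 1 * n * √n ^ n) := by ring
        _ ≤ 3 * (n + 2) * (√((n + 2 : ℕ) : ℝ) ^ n * (n + 2)) := by gcongr
        _ = _ := by rw [pow_add, sq_sqrt (by positivity)]; push_cast; ring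

/-! ### Chernoff bound for the volume -/

/-- The function equal to `t ^ 2` on `nearPowers ξ` and to `0` elsewhere. -/
noncomputable def nearSq (ξ t : ℝ) : ℝ := (nearPowers ξ).indicator (fun t => t ^ 2) t

theorem measurable_nearSq (ξ : ℝ) : Measurable (nearSq ξ) :=
  (measurable_id.pow_const 2).indicator (measurableSet_nearPowers ξ)

theorem nearSq_nonneg (ξ t : ℝ) : 0 ≤ nearSq ξ t :=
  Set.indicator_nonneg (fun _ _ => sq_nonneg _) _

theorem nearSq_le (ξ t : ℝ) : nearSq ξ t ≤ t ^ 2 :=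
  Set.indicator_le_self' (fun _ _ => sq_nonneg _) _

theorem integrable_exp_nearSq {s : ℝ} (ξ : ℝ) (hs0 : 0 ≤ s) (hs : s < 1 / 2) :
    Integrable (fun t => exp (s * nearSq ξ t - t ^ 2 / 2)) := by
  refine (integrable_exp_neg_mul_sq (b := 1 / 2 - s) (by linarith)).mono' ?_ ?_
  · have := measurable_nearSq ξ
    exact Measurable.aestronglyMeasurable (by fun_prop)
  · refine ae_of_all _ fun t => ?_
    rw [norm_of_nonneg (exp_pos _).le, exp_le_exp]
    nlinarith [nearSq_le ξ t]

theorem integral_exp_nearSq_le {s ξ : ℝ} (hs0 : 0 ≤ s) (hs : s < 1 / 2) (hξ : 0 < ξ)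
    (hξ4 : ξ ≤ 1 / 4) :
    ∫ t, exp (s * nearSq ξ t - t ^ 2 / 2) ≤ √(2 * π) + 27 * ξ / (1 / 2 - s) := by
  have hc : 0 < 1 / 2 - s := by linarith
  have hgauss : ∫⁻ t : ℝ, ENNReal.ofReal (exp (-(1 / 2) * t ^ 2)) = ENNReal.ofReal √(2 * π) := by
    rw [← ofReal_integral_eq_lintegral_ofReal (integrable_exp_neg_mul_sq (by norm_num))
      (ae_of_all _ fun t => (exp_pos _).le), integral_gaussian]
    congr 2; ring
  rw [← ENNReal.ofReal_le_ofReal_iff (by positivity),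
    ofReal_integral_eq_lintegral_ofReal (integrable_exp_nearSq ξ hs0 hs)
      (ae_of_all _ fun t => (exp_pos _).le), ENNReal.ofReal_add (by positivity) (by positivity)]
  calc _ ≤ ∫⁻ t, (ENNReal.ofReal (exp (-(1 / 2) * t ^ 2)) +
        (nearPowers ξ).indicator (fun t => ENNReal.ofReal (exp (-(1 / 2 - s) * t ^ 2))) t) := by
        refine lintegral_mono fun t => ?_
        by_cases ht : t ∈ nearPowers ξ
        · simp only [nearSq, Set.indicator_of_mem ht]
          refine le_trans (le_of_eq ?_) le_add_self
          congr 2; ring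
        · simp only [nearSq, Set.indicator_of_notMem ht, add_zero]
          apply le_of_eq; congr 2; ring
    _ = _ := by
        rw [lintegral_add_left (by fun_prop), lintegral_indicator (measurableSet_nearPowers ξ)]
    _ ≤ _ := by
        rw [hgauss]
        gcongr
        exact lintegral_nearPowers_le hc (by linarith) hξ hξ4

/-- Points of the Euclidean ball of radius `√n` whose mass on the coordinates near powers of `4`
is at least `b n`. -/
def heavySet (n : ℕ) (ξ b : ℝ) : Set (EuclideanSpace ℝ (Fin n)) :=
  {x | ∑ i, x i ^ 2 ≤ n ∧ b * n ≤ ∑ i, nearSq ξ (x i)}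

theorem volume_heavySet_le (n : ℕ) {s ξ : ℝ} (b : ℝ) (hs0 : 0 ≤ s) (hs : s < 1 / 2)
    (hξ : 0 < ξ) (hξ4 : ξ ≤ 1 / 4) :
    volume (heavySet n ξ b) ≤
      ENNReal.ofReal ((exp (1 / 2 - s * b) * (√(2 * π) + 27 * ξ / (1 / 2 - s))) ^ n) := by
  have hc : 0 < 1 / 2 - s := by linarith
  set w : ℝ → ℝ := fun t => exp (1 / 2 - s * b) * exp (s * nearSq ξ t - t ^ 2 / 2) with hw
  have hwint : Integrable w := (integrable_exp_nearSq ξ hs0 hs).const_mul _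
  have hwpos : ∀ t, 0 < w t := fun t => by positivity
  have hpre : volume (heavySet n ξ b) ≤ volume ((WithLp.toLp 2) ⁻¹' heavySet n ξ b) := by
    rw [(PiLp.volume_preserving_toLp (Fin n)).measure_preimage]
    refine MeasurableSet.nullMeasurableSet ?_
    have := measurable_nearSq ξ
    exact (measurableSet_le (f := fun x : EuclideanSpace ℝ (Fin n) => ∑ i, x i ^ 2)
        (g := fun _ => (n : ℝ)) (by fun_prop) measurable_const).inter
      (measurableSet_le (f := fun _ : EuclideanSpace ℝ (Fin n) => b * n)
        (g := fun x => ∑ i, nearSq ξ (x i)) measurable_const (by fun_prop))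
  calc _ ≤ _ := hpre
    _ = ∫⁻ x in (WithLp.toLp 2) ⁻¹' heavySet n ξ b, 1 := by simp
    -- Markov: the product weight is at least 1 on the set, as both defining inequalities enter its
    -- exponent with nonnegative sign.
    _ ≤ ∫⁻ x in (WithLp.toLp 2) ⁻¹' heavySet n ξ b, ENNReal.ofReal (∏ i, w (x i)) := by
        refine setLIntegral_mono (by
          have := measurable_nearSq ξ
          fun_prop) fun x hx => ?_
        obtain ⟨h1, h2⟩ := hx
        simp only at h1 h2
        rw [ENNReal.one_le_ofReal]
        simp only [hw, ← exp_add, ← exp_sum]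
        rw [one_le_exp_iff]
        have : ∑ i, (1 / 2 - s * b + (s * nearSq ξ (x i) - x i ^ 2 / 2))
            = (n - ∑ i, x i ^ 2) / 2 + s * (∑ i, nearSq ξ (x i) - b * n) := by
          simp only [Finset.sum_add_distrib, Finset.sum_sub_distrib, ← Finset.mul_sum,
            ← Finset.sum_div, Finset.sum_const, Finset.card_univ, Fintype.card_fin, nsmul_eq_mul]
          ring
        rw [this]
        exact add_nonneg (by linarith) (mul_nonneg hs0 (by linarith))
    _ ≤ ∫⁻ x : Fin n → ℝ, ENNReal.ofReal (∏ i, w (x i)) := setLIntegral_le_lintegral _ _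
    _ = ENNReal.ofReal ((∫ t, w t) ^ n) := by
        have hprod : Integrable (fun x : Fin n → ℝ => ∏ i, w (x i)) :=
          Integrable.fintype_prod fun _ => hwint
        rw [← ofReal_integral_eq_lintegral_ofReal hprod
          (ae_of_all _ fun x => Finset.prod_nonneg fun i _ => (hwpos _).le),
          integral_fintype_prod_volume_eq_prod (fun _ : Fin n => w)]
        simp
    _ ≤ _ := by
        refine ENNReal.ofReal_le_ofReal ?_
        rw [hw, integral_const_mul]
        have h0 : 0 ≤ ∫ t, exp (s * nearSq ξ t - t ^ 2 / 2) :=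
          integral_nonneg fun t => (exp_pos _).le
        gcongr
        exact integral_exp_nearSq_le hs0 hs hξ hξ4

theorem volume_heavySet_le_volume_ball (n : ℕ) (hn : 0 < n) {s ξ : ℝ} (b : ℝ) (hs0 : 0 ≤ s)
    (hs : s < 1 / 2) (hξ : 0 < ξ) (hξ4 : ξ ≤ 1 / 4) :
    volume (heavySet n ξ b) ≤
      ENNReal.ofReal (3 * n * exp (27 * ξ / (1 / 2 - s) - s * b) ^ n) *
        volume (Metric.ball (0 : EuclideanSpace ℝ (Fin n)) √n) := by
  have : Nonempty (Fin n) := ⟨⟨0, hn⟩⟩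
  have hc : 0 < 1 / 2 - s := by linarith
  refine (volume_heavySet_le n b hs0 hs hξ hξ4).trans ?_
  rw [EuclideanSpace.volume_ball, Fintype.card_fin, ← ENNReal.ofReal_pow (sqrt_nonneg _),
    ← ENNReal.ofReal_mul (by positivity), ← ENNReal.ofReal_mul (by positivity)]
  refine ENNReal.ofReal_le_ofReal ?_
  have hG := Gamma_half_add_one_le n hn
  have hGpos : 0 < Gamma ((n : ℝ) / 2 + 1) := Gamma_pos_of_pos (by positivity)
  have h1 : √(2 * π) + 27 * ξ / (1 / 2 - s) ≤ √(2 * π) * exp (27 * ξ / (1 / 2 - s)) := by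
    have h2 : 1 ≤ √(2 * π) := by rw [one_le_sqrt]; linarith [pi_gt_three]
    have h3 := add_one_le_exp (27 * ξ / (1 / 2 - s))
    have h4 : 0 < 27 * ξ / (1 / 2 - s) := by positivity
    nlinarith
  have h5 : exp (1 / 2 - s * b) * (√(2 * π) * exp (27 * ξ / (1 / 2 - s)))
      = exp (27 * ξ / (1 / 2 - s) - s * b) * √(2 * exp 1) * √π := by
    have h6 : √(exp 1) = exp (1 / 2) := by rw [sqrt_eq_rpow, ← exp_mul]; norm_num
    rw [sqrt_mul (by norm_num), sqrt_mul (by norm_num), h6, exp_sub, exp_sub]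
    field_simp
  calc _ ≤ (exp (1 / 2 - s * b) * (√(2 * π) * exp (27 * ξ / (1 / 2 - s)))) ^ n := by gcongr
    _ = exp (27 * ξ / (1 / 2 - s) - s * b) ^ n * √π ^ n * √(2 * exp 1) ^ n := by
        rw [h5]; ring
    _ ≤ exp (27 * ξ / (1 / 2 - s) - s * b) ^ n * √π ^ n *
        (3 * n * √n ^ n / Gamma ((n : ℝ) / 2 + 1)) := by
        gcongr
        rw [le_div_iff₀ hGpos]
        linarith
    _ = _ := by ring

/-! ### From the sphere to a shell -/

theorem unitVectorLaw_le_of_shell {n : ℕ} (hn : 0 < n) {δ : ℝ} (hδ1 : δ ≤ 1)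
    (hδn : (1 - δ) ^ n ≤ 1 / 2) {E S : Set (EuclideanSpace ℝ (Fin n))} (hE : MeasurableSet E)
    (hES : ∀ x ∈ E, ‖x‖ = √n → ∀ r ∈ Set.Icc (1 - δ) 1, r • x ∈ S) :
    unitVectorLaw n E ≤
      2 * (volume S / volume (Metric.ball (0 : EuclideanSpace ℝ (Fin n)) √n)) := by
  have hnr : 0 < √(n : ℝ) := sqrt_pos.2 (by exact_mod_cast hn)
  have : Nonempty (Fin n) := ⟨⟨0, hn⟩⟩
  set φ : Metric.sphere (0 : EuclideanSpace ℝ (Fin n)) 1 → EuclideanSpace ℝ (Fin n) :=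
    fun u => √n • (u : EuclideanSpace ℝ (Fin n)) with hφ
  have hφm : Measurable φ := by fun_prop
  set C : Set (EuclideanSpace ℝ (Fin n)) := Set.Ioo (0 : ℝ) 1 • ((↑) '' (φ ⁻¹' E)) with hC
  have hfin : Module.finrank ℝ (EuclideanSpace ℝ (Fin n)) = n := by simp
  have hCball : C ⊆ Metric.ball 0 1 := by
    rintro _ ⟨r, hr, _, ⟨u, -, rfl⟩, rfl⟩
    simp only [mem_ball_zero_iff, norm_smul, norm_eq_of_mem_sphere, mul_one, norm_eq_abs]
    rw [abs_of_pos hr.1]; exact hr.2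
  have hCfin : volume C ≠ ⊤ :=
    ne_top_of_le_ne_top measure_ball_lt_top.ne (measure_mono hCball)
  -- The part of the cone below radius 1 - δ is a scaled copy with at most half the volume, so the
  -- shell holds the other half.
  have hsub : C ⊆ (√n)⁻¹ • S ∪ (1 - δ) • C := by
    rintro _ ⟨r, hr, _, ⟨u, hu, rfl⟩, rfl⟩
    rcases le_or_gt (1 - δ) r with h | h
    · left
      rw [Set.mem_inv_smul_set_iff₀ hnr.ne']
      have := hES _ hu (by
        rw [hφ]; simp only [norm_smul, norm_eq_of_mem_sphere, mul_one, norm_eq_abs]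
        exact abs_of_pos hnr) r ⟨h, hr.2.le⟩
      simp only [hφ] at this
      rwa [smul_comm] at this
    · right
      have hpos : 0 < 1 - δ := hr.1.trans h
      refine ⟨(r / (1 - δ)) • (u : EuclideanSpace ℝ (Fin n)), ⟨r / (1 - δ),
        ⟨div_pos hr.1 hpos, (div_lt_one hpos).2 h⟩, u, ⟨u, hu, rfl⟩, rfl⟩, ?_⟩
      simp only [smul_smul]
      rw [mul_div_cancel₀ _ hpos.ne']
  have hvol : volume C ≤ 2 * volume ((√n)⁻¹ • S) := by
    have h1 : volume C ≤ volume ((√n)⁻¹ • S) + 2⁻¹ * volume C := by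
      refine (measure_mono hsub).trans ((measure_union_le _ _).trans ?_)
      gcongr
      rw [Measure.addHaar_smul, hfin]
      gcongr
      rw [abs_of_nonneg (pow_nonneg (by linarith) _)]
      calc _ ≤ ENNReal.ofReal (1 / 2) := ENNReal.ofReal_le_ofReal hδn
        _ = 2⁻¹ := by rw [one_div, ENNReal.ofReal_inv_of_pos (by norm_num)]; simp
    have h2 : 2⁻¹ * volume C + 2⁻¹ * volume C ≤ volume ((√n)⁻¹ • S) + 2⁻¹ * volume C := by
      rwa [← add_mul, ENNReal.inv_two_add_inv_two, one_mul]
    have h3 : 2⁻¹ * volume C ≤ volume ((√n)⁻¹ • S) :=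
      (ENNReal.add_le_add_iff_right (ENNReal.mul_ne_top (by simp) hCfin)).1 h2
    calc volume C = 2 * (2⁻¹ * volume C) := by
          rw [← mul_assoc, ENNReal.mul_inv_cancel (by simp) (by simp), one_mul]
      _ ≤ _ := by gcongr
  have hball : volume (Metric.ball (0 : EuclideanSpace ℝ (Fin n)) √n)
      = ENNReal.ofReal (√n ^ n) * volume (Metric.ball (0 : EuclideanSpace ℝ (Fin n)) 1) := by
    rw [Measure.addHaar_ball_of_pos _ _ hnr, hfin]
  have hSscale : volume S = ENNReal.ofReal (√n ^ n) * volume ((√n)⁻¹ • S) := by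
    conv_lhs => rw [← smul_inv_smul₀ hnr.ne' S]
    rw [Measure.addHaar_smul, hfin, abs_of_pos (by positivity)]
  have hn0 : (n : ENNReal) ≠ 0 := by exact_mod_cast hn.ne'
  have hs0 : ENNReal.ofReal (√n ^ n) ≠ 0 := by
    rw [Ne, ENNReal.ofReal_eq_zero, not_le]; positivity
  rw [unitVectorLaw, Measure.map_apply hφm hE, Measure.smul_apply, Measure.toSphere_apply_univ,
    Measure.toSphere_apply' _ (hφm hE), hfin, smul_eq_mul, mul_comm, ← div_eq_mul_inv,
    ENNReal.mul_div_mul_left _ _ hn0 (by simp), hball, hSscale,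
    ENNReal.mul_div_mul_left _ _ hs0 ENNReal.ofReal_ne_top, ← mul_div_assoc]
  gcongr

/-! ### Stability of the coordinate weight under perturbation -/

theorem avgNorm_eq {n : ℕ} (x : EuclideanSpace ℝ (Fin n)) : avgNorm x = (√n)⁻¹ * ‖x‖ := by
  rw [avgNorm, EuclideanSpace.norm_eq, sqrt_mul (by positivity), sqrt_inv]
  simp

theorem coordWeight_eq {n : ℕ} (x : EuclideanSpace ℝ (Fin n)) (J : Set (Fin n)) :
    coordWeight x J = (∑ i, J.indicator (fun i => x i ^ 2) i) / ‖x‖ ^ 2 := by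
  rcases Nat.eq_zero_or_pos n with rfl | hn
  · simp [coordWeight, avgNorm]
  have hnr : 0 < √(n : ℝ) := sqrt_pos.2 (by exact_mod_cast hn)
  have h : ‖coordProj J x‖ ^ 2 = ∑ i, J.indicator (fun i => x i ^ 2) i := by
    rw [EuclideanSpace.norm_sq_eq]
    refine Finset.sum_congr rfl fun i _ => ?_
    by_cases hi : i ∈ J <;> simp [coordProj, hi]
  rw [coordWeight, avgNorm_eq, avgNorm_eq, mul_pow, mul_pow, h, mul_div_mul_left]
  positivity

theorem isApproxPower_zero_iff {t : ℝ} : IsApproxPower 4 0 t ↔ ∃ m : ℤ, t = (4 : ℝ) ^ m := by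
  simp only [IsApproxPower, add_zero, inv_one, one_mul]
  exact exists_congr fun m => ⟨fun h => le_antisymm h.2 h.1, fun h => ⟨h.ge, h.le⟩⟩

theorem mem_heavySet_of_near {n : ℕ} {γ ξ δ η : ℝ} (hγ : 0 ≤ γ) (hξ : 0 < ξ) (hξ1 : ξ ≤ 1)
    (hδη : δ + η ≤ 1) {a y : EuclideanSpace ℝ (Fin n)} (ha : a ∈ Delta n 4 γ)
    (hy : ‖y‖ ≤ √n) (hy' : (1 - δ) * √n ≤ ‖y‖) (hay : ‖y - a‖ ≤ η * √n) :
    y ∈ heavySet n ξ ((1 - ξ) ^ 2 * (γ * (1 - δ - η) ^ 2 - η ^ 2 / ξ ^ 2)) := by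
  classical
  have hsq : √(n : ℝ) ^ 2 = n := sq_sqrt (by positivity)
  obtain ⟨ha0, haw⟩ := ha
  set J : Set (Fin n) := {i | IsApproxPower 4 0 |a i|} with hJ
  refine ⟨?_, ?_⟩
  · rw [← EuclideanSpace.real_norm_sq_eq, ← hsq]; gcongr
  have hapos : 0 < ‖a‖ := norm_pos_iff.2 ha0
  have haw' : γ * ‖a‖ ^ 2 ≤ ∑ i, J.indicator (fun i => a i ^ 2) i := by
    rwa [coordWeight_eq, le_div_iff₀ (by positivity)] at haw
  have hanorm : (1 - δ - η) * √n ≤ ‖a‖ := by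
    have := norm_sub_norm_le y a
    linarith
  have ha2 : (1 - δ - η) ^ 2 * n ≤ ‖a‖ ^ 2 := by
    rw [← hsq, ← mul_pow]
    exact pow_le_pow_left₀ (mul_nonneg (by linarith) (sqrt_nonneg _)) hanorm 2
  have hd2 : ∑ i, (y i - a i) ^ 2 ≤ η ^ 2 * n := by
    have : ∑ i, (y i - a i) ^ 2 = ‖y - a‖ ^ 2 := by
      rw [EuclideanSpace.real_norm_sq_eq]; simp
    rw [this, ← hsq, ← mul_pow]; gcongr
  -- Either the coordinate moves by at most ξ|aᵢ| and stays near its power of 4, or aᵢ² is paid for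
  -- by the displacement.
  have hpt : ∀ i, (1 - ξ) ^ 2 * (J.indicator (fun i => a i ^ 2) i - (y i - a i) ^ 2 / ξ ^ 2)
      ≤ nearSq ξ (y i) := by
    intro i
    have h0 := nearSq_nonneg ξ (y i)
    by_cases hi : i ∈ J
    · rw [Set.indicator_of_mem hi]
      rcases le_or_gt |y i - a i| (ξ * |a i|) with h | h
      · have habs : |(|y i| - |a i|)| ≤ ξ * |a i| := (abs_abs_sub_abs_le _ _).trans h
        obtain ⟨m, hm⟩ := isApproxPower_zero_iff.1 hi
        have hmem : y i ∈ nearPowers ξ := ⟨m, by rw [← hm]; exact habs⟩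
        rw [nearSq, Set.indicator_of_mem hmem]
        have h1 : (1 - ξ) * |a i| ≤ |y i| := by linarith [(abs_le.1 habs).1]
        have h2 : ((1 - ξ) * |a i|) ^ 2 ≤ |y i| ^ 2 :=
          pow_le_pow_left₀ (mul_nonneg (by linarith) (abs_nonneg _)) h1 2
        rw [mul_pow, sq_abs, sq_abs] at h2
        have h3 : 0 ≤ (1 - ξ) ^ 2 * ((y i - a i) ^ 2 / ξ ^ 2) := by positivity
        linarith
      · have h1 : (ξ * |a i|) ^ 2 ≤ |y i - a i| ^ 2 := by gcongr
        rw [mul_pow, sq_abs, sq_abs] at h1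
        have h2 : a i ^ 2 ≤ (y i - a i) ^ 2 / ξ ^ 2 := by
          rw [le_div_iff₀ (by positivity)]; linarith
        exact (mul_nonpos_of_nonneg_of_nonpos (sq_nonneg _) (by linarith)).trans h0
    · rw [Set.indicator_of_notMem hi]
      have h2 : 0 ≤ (y i - a i) ^ 2 / ξ ^ 2 := by positivity
      exact (mul_nonpos_of_nonneg_of_nonpos (sq_nonneg _) (by linarith)).trans h0
  calc _ = (1 - ξ) ^ 2 * (γ * ((1 - δ - η) ^ 2 * n) - (η ^ 2 * n) / ξ ^ 2) := by ring
    _ ≤ (1 - ξ) ^ 2 * (∑ i, J.indicator (fun i => a i ^ 2) i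
          - (∑ i, (y i - a i) ^ 2) / ξ ^ 2) := by
        have := mul_le_mul_of_nonneg_left ha2 hγ
        gcongr
        linarith
    _ = ∑ i, (1 - ξ) ^ 2 * (J.indicator (fun i => a i ^ 2) i - (y i - a i) ^ 2 / ξ ^ 2) := by
        rw [← Finset.mul_sum, Finset.sum_sub_distrib, Finset.sum_div]
    _ ≤ _ := Finset.sum_le_sum fun i _ => hpt i

/-- In η + 2δ, one δ pays for passing from the closed thickening, which is measurable, to an actual
nearby point, and one for the radial move within the shell. -/
theorem unitVectorLaw_expansion_le {n : ℕ} (hn : 0 < n) {γ ξ δ η s : ℝ} (hγ : 0 ≤ γ) (hξ : 0 < ξ)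
    (hξ4 : ξ ≤ 1 / 4) (hδ : 0 < δ) (hη : 0 ≤ η) (hδη : 3 * δ + η ≤ 1) (hs0 : 0 ≤ s)
    (hs : s < 1 / 2) (hδn : (1 - δ) ^ n ≤ 1 / 2) :
    unitVectorLaw n (expansion η (Delta n 4 γ)) ≤
      ENNReal.ofReal (6 * n * exp (27 * ξ / (1 / 2 - s) - s * ((1 - ξ) ^ 2 *
        (γ * (1 - δ - (η + 2 * δ)) ^ 2 - (η + 2 * δ) ^ 2 / ξ ^ 2))) ^ n) := by
  have hnr : 0 < √(n : ℝ) := sqrt_pos.2 (by exact_mod_cast hn)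
  set b := (1 - ξ) ^ 2 * (γ * (1 - δ - (η + 2 * δ)) ^ 2 - (η + 2 * δ) ^ 2 / ξ ^ 2) with hb
  have hsub : expansion η (Delta n 4 γ) ⊆ Metric.cthickening (η * √n) (Delta n 4 γ) := by
    rintro x ⟨a, ha, hxa⟩
    refine Metric.mem_cthickening_of_dist_le x a _ _ ha ?_
    rw [avgNorm_eq, inv_mul_le_iff₀ hnr] at hxa
    rw [dist_eq_norm]; linarith
  have hshell := unitVectorLaw_le_of_shell hn (δ := δ) (by linarith) hδn (S := heavySet n ξ b)
    (Metric.isClosed_cthickening (δ := η * √n) (E := Delta n 4 γ)).measurableSet (by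
      intro x hx hxn r hr
      have hx' : x ∈ Metric.thickening ((η + δ) * √n) (Delta n 4 γ) :=
        Metric.cthickening_subset_thickening' (by positivity) (by nlinarith) _ hx
      obtain ⟨a, ha, hxa⟩ := Metric.mem_thickening_iff.1 hx'
      have hr0 : 0 ≤ r := by linarith [hr.1]
      have hrx : ‖r • x‖ = r * √n := by rw [norm_smul, hxn, norm_of_nonneg hr0]
      refine mem_heavySet_of_near hγ hξ (by linarith) (by linarith) ha ?_ ?_ ?_
      · rw [hrx]; nlinarith [hr.2]
      · rw [hrx]; nlinarith [hr.1]
      · have h1 : ‖r • x - x‖ ≤ δ * √n := by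
          have : r • x - x = (r - 1) • x := by rw [sub_smul, one_smul]
          rw [this, norm_smul, hxn, norm_eq_abs, abs_of_nonpos (by linarith [hr.2])]
          nlinarith [hr.1]
        rw [dist_eq_norm] at hxa
        calc _ ≤ ‖r • x - x‖ + ‖x - a‖ := norm_sub_le_norm_sub_add_norm_sub _ _ _
          _ ≤ _ := by linarith)
  calc _ ≤ _ := measure_mono hsub
    _ ≤ _ := hshell
    _ ≤ 2 * ENNReal.ofReal (3 * n * exp (27 * ξ / (1 / 2 - s) - s * b) ^ n) := by
        gcongr
        exact ENNReal.div_le_of_le_mul (volume_heavySet_le_volume_ball n hn b hs0 hs hξ hξ4)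
    _ = _ := by
        rw [show (2 : ENNReal) = ENNReal.ofReal 2 by simp, ← ENNReal.ofReal_mul (by norm_num)]
        congr 1; ring

theorem expansion_Delta_mono {n : ℕ} {lam γ γ' η η' : ℝ} (hγ : γ' ≤ γ) (hη : η ≤ η') :
    expansion η (Delta n lam γ) ⊆ expansion η' (Delta n lam γ') := by
  rintro x ⟨a, ⟨ha0, ha⟩, hxa⟩
  exact ⟨a, ⟨ha0, hγ.trans ha⟩, hxa.trans hη⟩

theorem eventually_pow_le_half {δ : ℝ} (hδ : 0 < δ) (hδ1 : δ ≤ 1) :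
    ∀ᶠ n : ℕ in atTop, (1 - δ) ^ n ≤ 1 / 2 :=
  (tendsto_pow_atTop_nhds_zero_of_lt_one (by linarith) (by linarith)).eventually_le_const
    (by norm_num)

theorem eventually_six_mul_pow_le {q σ : ℝ} (hq : 0 ≤ q) (hqσ : q < σ) :
    ∀ᶠ n : ℕ in atTop, 6 * n * q ^ n ≤ σ ^ n := by
  have hσ : 0 < σ := hq.trans_lt hqσ
  have h := (tendsto_self_mul_const_pow_of_lt_one (r := q / σ) (by positivity)
    ((div_lt_one hσ).2 hqσ)).eventually_le_const (show (0 : ℝ) < 1 / 6 by norm_num)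
  filter_upwards [h] with n hn
  rw [div_pow, ← mul_div_assoc, div_le_iff₀ (by positivity)] at hn
  linarith

end TennisBall

/-! ### Choice of constants -/

theorem mainTheorem5 :
    (∀ β : ℝ, 0 < β → β ≤ 1 →
      ∃ η₀ : ℝ, 0 < η₀ ∧ η₀ < 1 / 2 ∧ ∃ σ : ℝ, 0 < σ ∧ σ < 1 ∧
        ∀ η : ℝ, 0 < η → η ≤ η₀ →
          ∀ᶠ n : ℕ in atTop,
            TennisBall.unitVectorLaw n
                (TennisBall.expansion η (TennisBall.Delta n 4 (β * (1 - 2 * η))))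
              ≤ ENNReal.ofReal (σ ^ n)) ∧
    (∀ η β : ℝ, η = 1 / 10 ^ 12 → β = 1 / 257 →
      ∀ᶠ n : ℕ in atTop,
        TennisBall.unitVectorLaw n
            (TennisBall.expansion η (TennisBall.Delta n 4 (β * (1 - 2 * η))))
          ≤ ENNReal.ofReal
              (4 * Real.exp 1 * (n : ℝ) ^ 2 * Real.log (n : ℝ) * (0.9982 : ℝ) ^ n)) := by
  refine ⟨fun β hβ hβ1 => ?_, fun η β hη hβ => ?_⟩
  -- With ξ of order β and η₀ of order β², the errors 108ξ and (3η₀/ξ)² are small against β.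
  · set η₀ : ℝ := β ^ 2 / 10 ^ 6 with hη₀
    have hη₀pos : 0 < η₀ := by positivity
    have hη₀le : η₀ ≤ 1 / 10 ^ 6 := by
      rw [hη₀]; gcongr; nlinarith
    set ξ : ℝ := β / 10 ^ 4 with hξ
    have hξpos : 0 < ξ := by positivity
    have hξle : ξ ≤ 1 / 10 ^ 4 := by rw [hξ]; gcongr
    refine ⟨η₀, hη₀pos, by linarith, Real.exp (-(β / 100)), Real.exp_pos _, by
      rw [Real.exp_lt_one_iff]; linarith, fun η hη hηle => ?_⟩
    have hq : Real.exp (-(β / 50)) < Real.exp (-(β / 100)) := Real.exp_lt_exp.2 (by linarith)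
    filter_upwards [eventually_gt_atTop 0,
      TennisBall.eventually_pow_le_half hη₀pos (by linarith),
      TennisBall.eventually_six_mul_pow_le (Real.exp_pos _).le hq] with n hn hhalf hpow
    -- Enlarging η to η₀ makes the rate independent of η.
    refine (measure_mono (TennisBall.expansion_Delta_mono (γ' := β * (1 - 2 * η₀))
      (by gcongr) hηle)).trans ?_
    refine (TennisBall.unitVectorLaw_expansion_le hn (mul_nonneg hβ.le (by linarith)) hξpos
      (by linarith) hη₀pos hη₀pos.le (by linarith) (s := 1 / 4) (by norm_num) (by norm_num)
      hhalf).trans (ENNReal.ofReal_le_ofReal (le_trans ?_ hpow))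
    gcongr
    have h1 : (η₀ + 2 * η₀) ^ 2 / ξ ^ 2 = 9 / 10 ^ 4 * β ^ 2 := by
      rw [hη₀, hξ]; field_simp; ring
    have h2 : (9 / 10 : ℝ) ≤ (1 - η₀ - (η₀ + 2 * η₀)) ^ 2 := by nlinarith
    have h3 : (9 / 10 : ℝ) ≤ (1 - ξ) ^ 2 := by nlinarith
    have h4 : β * (8 / 10) ≤ β * (1 - 2 * η₀) * (1 - η₀ - (η₀ + 2 * η₀)) ^ 2 := by
      rw [mul_assoc]; gcongr; nlinarith
    have h5 : β * (7 / 10) ≤ β * (1 - 2 * η₀) * (1 - η₀ - (η₀ + 2 * η₀)) ^ 2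
        - (η₀ + 2 * η₀) ^ 2 / ξ ^ 2 := by
      rw [h1]; nlinarith
    have h6 := mul_le_mul h3 h5 (by positivity) (by positivity)
    have h7 : 27 * ξ / (1 / 2 - 1 / 4) = 108 / 10 ^ 4 * β := by rw [hξ]; ring
    rw [h7]
    linarith
  · subst hη hβ
    filter_upwards [eventually_ge_atTop 3,
      TennisBall.eventually_pow_le_half (δ := 1 / 10 ^ 12) (by norm_num) (by norm_num)]
      with n hn hhalf
    have hnr : (3 : ℝ) ≤ n := by exact_mod_cast hn
    refine (TennisBall.unitVectorLaw_expansion_le (by omega) (by norm_num) (ξ := 1 / 10 ^ 8)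
      (by norm_num) (by norm_num) (by norm_num) (by norm_num) (by norm_num) (s := 48 / 100)
      (by norm_num) (by norm_num) hhalf).trans (ENNReal.ofReal_le_ofReal ?_)
    -- The exponent is about 1.35·10⁻⁵ - 0.48/257 ≈ -0.001854.
    have hexp : ∀ u : ℝ, u ≤ -(185 / 100000) → Real.exp u ≤ 0.9982 := by
      intro u hu
      have h1 := Real.add_one_le_exp (185 / 100000 : ℝ)
      calc Real.exp u ≤ Real.exp (-(185 / 100000)) := Real.exp_le_exp.2 hu
        _ = (Real.exp (185 / 100000))⁻¹ := Real.exp_neg _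
        _ ≤ (185 / 100000 + 1)⁻¹ := inv_anti₀ (by norm_num) h1
        _ ≤ _ := by norm_num
    have hlog : 1 ≤ Real.log n := by
      rw [Real.le_log_iff_exp_le (by linarith)]
      linarith [Real.exp_one_lt_d9]
    have hcoef : 6 * (n : ℝ) ≤ 4 * Real.exp 1 * (n : ℝ) ^ 2 * Real.log n := by
      have he := Real.exp_one_gt_d9
      calc 6 * (n : ℝ) ≤ 4 * 2 * (n : ℝ) ^ 2 * 1 := by nlinarith
        _ ≤ _ := by gcongr; linarith
    gcongr
    exact hexp _ (by norm_num)
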